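/- Let $\mu>0$ and let $X_1,X_2,\dots$ be independent random variables having a common exponential distribution with density $\lambda e^{-\lambda x}$, $x\ge 0$, for some $\lambda>0$ (the null hypothesis). For $n\ge 2$ put $$H_n(t)=\frac1{n(n-1)}\sum_{1\le i<j\le n}\Big(\mathbf 1\{X_i/X_j<t\}+\mathbf 1\{X_j/X_i<t\}\Big),\qquad W_n=\int_0^\infty\Big(\frac t{1+t}-H_n(t)\Big)\mu e^{-\mu t}\,dt .$$ Let $E_1(\mu)=\int_1^\infty e^{-\mu t}t^{-1}\,dt$, let $K_1$ be the modified Bessel function of the second kind of order $1$, so $K_1(y)=\int_0^\infty e^{-y\cosh t}\cosh t\,dt$ for $y>0$, and let $$\Phi(x,y)=1-\mu e^{\mu}E_1(\mu)-\tfrac12e^{-\mu x/y}-\tfrac12e^{-\mu y/x}\quad(x,y>0),\qquad \varphi_\mu(s)=\mathbb E\,\Phi(s,Y),\qquad \Delta_W^2(\mu)=\int_0^\infty\varphi_\mu^2(s)e^{-s}\,ds,$$ where $X,Y$ are independent standard exponential random variables. Then: 1. almost surely, $W_n=\frac{2}{n(n-1)}\sum_{1\le i<j\le n}\Phi(X_i,X_j)$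 for every $n\ge2$, that is, $W_n$ is the $U$-statistic of degree $2$ with kernel $\Phi$; 2. the kernel is integrable and centred: $\mathbb E\,\Phi(X,Y)=0$; 3. its projection is $\varphi_\mu(s)=1-\mu e^{\mu}E_1(\mu)-\sqrt{\mu s}\,K_1(2\sqrt{\mu s})-\dfrac{s}{2(\mu+s)}$ for $s>0$; 4. $\Delta_W^2(\mu)$ is the (finite) variance of $\varphi_\mu(X)$, and $\Delta_W^2(\mu)>0$, that is, the kernel is non-degenerate; 5. as $n\to\infty$, $\sqrt n\,W_n\xrightarrow{d}\mathcal N\big(0,\,4\Delta_W^2(\mu)\big)$. -/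

import Mathlib

open MeasureTheory ProbabilityTheory Filter

namespace ExpTest

noncomputable section

/-- The exponential integral `E₁(μ) = ∫₁^∞ e^{-μ t} / t dt` (for `μ > 0`). -/
def expIntegralE1 (μ : ℝ) : ℝ :=
  ∫ t in Set.Ioi (1 : ℝ), Real.exp (-(μ * t)) / t

/-- The modified Bessel function of the second kind of order `1` at `y > 0`, through its
standard integral representation `K₁(y) = ∫₀^∞ e^{-y cosh t} cosh t dt`. -/
def besselK1 (y : ℝ) : ℝ :=
  ∫ t in Set.Ioi (0 : ℝ), Real.exp (-(y * Real.cosh t)) * Real.cosh t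

/-- The `U`-empirical distribution function at `t` of the ratios, for the sample
`x 0, …, x (n - 1)`:
`(1 / (n (n - 1))) ∑_{i < j} (1{x i / x j < t} + 1{x j / x i < t})`. -/
def ratioDF (n : ℕ) (x : ℕ → ℝ) (t : ℝ) : ℝ :=
  1 / ((n : ℝ) * ((n : ℝ) - 1)) *
    ∑ j ∈ Finset.range n, ∑ i ∈ Finset.range j,
      ((Set.Iio t).indicator (fun _ => (1 : ℝ)) (x i / x j) +
        (Set.Iio t).indicator (fun _ => (1 : ℝ)) (x j / x i))

/-- The integral statistic `∫₀^∞ (t / (1 + t) - H_n(t)) μ e^{-μ t} dt`. -/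
def statW (μ : ℝ) (n : ℕ) (x : ℕ → ℝ) : ℝ :=
  ∫ t in Set.Ioi (0 : ℝ), (t / (1 + t) - ratioDF n x t) * (μ * Real.exp (-(μ * t)))

/-- The symmetric kernel
`Φ(x, y) = 1 - μ e^μ E₁(μ) - e^{-μ x / y} / 2 - e^{-μ y / x} / 2`. -/
def kernel (μ x y : ℝ) : ℝ :=
  1 - μ * Real.exp μ * expIntegralE1 μ
    - 1 / 2 * Real.exp (-(μ * (x / y))) - 1 / 2 * Real.exp (-(μ * (y / x)))

/-- The projection `φ_μ(s) = E Φ(s, Y)` of the kernel, `Y` standard exponential. -/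
def projection (μ s : ℝ) : ℝ :=
  ∫ y, kernel μ s y ∂(expMeasure 1)

/-- `Δ_W²(μ) = ∫₀^∞ φ_μ(s)² e^{-s} ds`. -/
def deltaSq (μ : ℝ) : ℝ :=
  ∫ s in Set.Ioi (0 : ℝ), projection μ s ^ 2 * Real.exp (-s)

end

end ExpTest

section UStatistic

variable {Ω E : Type*} [MeasurableSpace Ω] [MeasurableSpace E] {P : Measure Ω}
  [IsProbabilityMeasure P] {ν : Measure E} {Y : ℕ → Ω → E}
  {g : E → E → ℝ}

lemma hasLaw_prodMk_of_iIndepFun (hind : iIndepFun Y P) (hlaw : ∀ i, HasLaw (Y i) ν P)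
    {i j : ℕ} (hij : i ≠ j) : HasLaw (fun ω => (Y i ω, Y j ω)) (ν.prod ν) P where
  aemeasurable := (hlaw i).aemeasurable.prodMk (hlaw j).aemeasurable
  map_eq := by
    have h := (indepFun_iff_map_prod_eq_prod_map_map (hlaw i).aemeasurable
      (hlaw j).aemeasurable).1 (hind.indepFun hij)
    rw [h, (hlaw i).map_eq, (hlaw j).map_eq]

lemma memLp_comp_pair (hind : iIndepFun Y P) (hlaw : ∀ i, HasLaw (Y i) ν P)
    (hg : MemLp (fun p : E × E => g p.1 p.2) 2 (ν.prod ν)) {i j : ℕ} (hij : i ≠ j) :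
    MemLp (fun ω => g (Y i ω) (Y j ω)) 2 P := by
  have h := hasLaw_prodMk_of_iIndepFun hind hlaw hij
  rw [← h.map_eq] at hg
  exact (memLp_map_measure_iff hg.1 h.aemeasurable).1 hg

variable [IsProbabilityMeasure ν]

/-- Two values of a degenerate kernel are orthogonal when one index occurs only once. -/
lemma integral_mul_of_degenerate_left (hind : iIndepFun Y P) (hlaw : ∀ i, HasLaw (Y i) ν P)
    (hgm : Measurable (fun p : E × E => g p.1 p.2))
    (hg : MemLp (fun p : E × E => g p.1 p.2) 2 (ν.prod ν))
    (hdeg : ∀ᵐ y ∂ν, ∫ x, g x y ∂ν = 0) {a b k l : ℕ} (hab : a ≠ b) (hak : a ≠ k)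
    (hal : a ≠ l) (hkl : k ≠ l) :
    ∫ ω, g (Y a ω) (Y b ω) * g (Y k ω) (Y l ω) ∂P = 0 := by
  classical
  let W : Ω → E × E × E := fun ω => (Y b ω, Y k ω, Y l ω)
  have hWm : AEMeasurable W P :=
    (hlaw b).aemeasurable.prodMk ((hlaw k).aemeasurable.prodMk (hlaw l).aemeasurable)
  have hindW : IndepFun (Y a) W P := by
    have h := hind.indepFun_finset₀ {a} {b, k, l} (by simp [hab, hak, hal])
      (fun i => (hlaw i).aemeasurable)
    exact h.comp (φ := fun u : (({a} : Finset ℕ) → E) => u ⟨a, by simp⟩)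
      (ψ := fun u : (({b, k, l} : Finset ℕ) → E) =>
        (u ⟨b, by simp⟩, u ⟨k, by simp⟩, u ⟨l, by simp⟩))
      (measurable_pi_apply _) (by fun_prop)
  have hmap := (indepFun_iff_map_prod_eq_prod_map_map (hlaw a).aemeasurable hWm).1 hindW
  rw [(hlaw a).map_eq] at hmap
  have : IsProbabilityMeasure (P.map W) := Measure.isProbabilityMeasure_map hWm
  have hFm : Measurable (fun p : E × E × E × E => g p.1 p.2.1 * g p.2.2.1 p.2.2.2) := by
    have h1 : Measurable (fun p : E × E × E × E => g p.1 p.2.1) :=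
      hgm.comp (f := fun p : E × E × E × E => (p.1, p.2.1)) (by fun_prop)
    have h2 : Measurable (fun p : E × E × E × E => g p.2.2.1 p.2.2.2) :=
      hgm.comp (f := fun p : E × E × E × E => (p.2.2.1, p.2.2.2)) (by fun_prop)
    exact h1.mul h2
  have hpm : AEMeasurable (fun ω => (Y a ω, W ω)) P := (hlaw a).aemeasurable.prodMk hWm
  have hint : Integrable (fun p : E × E × E × E => g p.1 p.2.1 * g p.2.2.1 p.2.2.2)
      (ν.prod (P.map W)) := by
    rw [← hmap, integrable_map_measure hFm.aestronglyMeasurable hpm]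
    exact (memLp_comp_pair hind hlaw hg hab).integrable_mul (memLp_comp_pair hind hlaw hg hkl)
  calc ∫ ω, g (Y a ω) (Y b ω) * g (Y k ω) (Y l ω) ∂P
      = ∫ p, g p.1 p.2.1 * g p.2.2.1 p.2.2.2 ∂(P.map (fun ω => (Y a ω, W ω))) := by
        rw [integral_map hpm hFm.aestronglyMeasurable]
    _ = ∫ w, ∫ x, g x w.1 * g w.2.1 w.2.2 ∂ν ∂(P.map W) := by
        rw [hmap, integral_prod_symm _ hint]
    _ = 0 := by
        refine integral_eq_zero_of_ae ?_
        have h1 : ∀ᵐ y ∂(P.map (Y b)), ∫ x, g x y ∂ν = 0 := by rwa [(hlaw b).map_eq]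
        have h2 : P.map (Y b) = (P.map W).map Prod.fst := by
          rw [AEMeasurable.map_map_of_aemeasurable measurable_fst.aemeasurable hWm]
          rfl
        rw [h2] at h1
        filter_upwards [ae_of_ae_map measurable_fst.aemeasurable h1] with w hw
        rw [integral_mul_const, hw]
        simp

lemma integrable_and_integral_sq_sum_degenerate (hind : iIndepFun Y P) (hlaw : ∀ i, HasLaw (Y i) ν P)
    (hgm : Measurable (fun p : E × E => g p.1 p.2)) (hsymm : ∀ x y, g x y = g y x)
    (hg : MemLp (fun p : E × E => g p.1 p.2) 2 (ν.prod ν))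
    (hdeg : ∀ᵐ y ∂ν, ∫ x, g x y ∂ν = 0) (n : ℕ) :
    Integrable (fun ω => (∑ j ∈ Finset.range n, ∑ i ∈ Finset.range j, g (Y i ω) (Y j ω)) ^ 2) P ∧
    ∫ ω, (∑ j ∈ Finset.range n, ∑ i ∈ Finset.range j, g (Y i ω) (Y j ω)) ^ 2 ∂P
      = (n : ℝ) * (n - 1) / 2 * ∫ p, g p.1 p.2 ^ 2 ∂(ν.prod ν) := by
  set S : Finset (Σ _ : ℕ, ℕ) := (Finset.range n).sigma Finset.range with hS
  have hlt : ∀ p ∈ S, p.2 ≠ p.1 := by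
    intro p hp
    simp only [hS, Finset.mem_sigma, Finset.mem_range] at hp
    exact hp.2.ne
  have hsum : ∀ ω, (∑ j ∈ Finset.range n, ∑ i ∈ Finset.range j, g (Y i ω) (Y j ω))
      = ∑ p ∈ S, g (Y p.2 ω) (Y p.1 ω) := fun ω => by
    rw [hS, Finset.sum_sigma]
  have hL : ∀ p ∈ S, MemLp (fun ω => g (Y p.2 ω) (Y p.1 ω)) 2 P := fun p hp =>
    memLp_comp_pair hind hlaw hg (hlt p hp)
  have hcard : (S.card : ℝ) = n * (n - 1) / 2 := by
    rw [hS, Finset.card_sigma]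
    simp only [Finset.card_range]
    rw [Finset.sum_range_id, Nat.cast_div (even_iff_two_dvd.1 (Nat.even_mul_pred_self n)) (by simp)]
    rcases n with _ | n <;> simp
  have hdiag : ∀ p ∈ S, ∫ ω, g (Y p.2 ω) (Y p.1 ω) * g (Y p.2 ω) (Y p.1 ω) ∂P
      = ∫ p, g p.1 p.2 ^ 2 ∂(ν.prod ν) := by
    intro p hp
    have h := hasLaw_prodMk_of_iIndepFun hind hlaw (hlt p hp)
    rw [← h.map_eq, integral_map h.aemeasurable (hgm.pow_const 2).aestronglyMeasurable]
    simp only [sq]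
  have hoff : ∀ p ∈ S, ∀ q ∈ S, p ≠ q →
      ∫ ω, g (Y p.2 ω) (Y p.1 ω) * g (Y q.2 ω) (Y q.1 ω) ∂P = 0 := by
    rintro ⟨j, i⟩ hp ⟨l, k⟩ hq hpq
    simp only [hS, Finset.mem_sigma, Finset.mem_range] at hp hq
    simp only
    rcases lt_trichotomy j l with hjl | rfl | hjl
    · have := integral_mul_of_degenerate_left hind hlaw hgm hg hdeg (a := l) (b := k) (k := i)
        (l := j) (by omega) (by omega) (by omega) (by omega)
      simpa only [hsymm (Y l _) (Y k _), mul_comm] using this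
    · have hik : i ≠ k := by rintro rfl; exact hpq rfl
      exact integral_mul_of_degenerate_left hind hlaw hgm hg hdeg (by omega) hik (by omega)
        (by omega)
    · have := integral_mul_of_degenerate_left hind hlaw hgm hg hdeg (a := j) (b := i) (k := k)
        (l := l) (by omega) (by omega) (by omega) (by omega)
      simpa only [hsymm (Y j _) (Y i _)] using this
  have hpi : ∀ p ∈ S, ∀ q ∈ S,
      Integrable (fun ω => g (Y p.2 ω) (Y p.1 ω) * g (Y q.2 ω) (Y q.1 ω)) P :=
    fun p hp q hq => (hL p hp).integrable_mul (hL q hq)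
  simp_rw [hsum, sq, Finset.sum_mul_sum]
  refine ⟨integrable_finsetSum _ fun p hp => integrable_finsetSum _ fun q hq => hpi p hp q hq, ?_⟩
  rw [integral_finsetSum _ fun p hp => integrable_finsetSum _ fun q hq => hpi p hp q hq]
  have : ∀ p ∈ S, ∫ ω, ∑ q ∈ S, g (Y p.2 ω) (Y p.1 ω) * g (Y q.2 ω) (Y q.1 ω) ∂P
      = ∫ p, g p.1 p.2 ^ 2 ∂(ν.prod ν) := by
    intro p hp
    rw [integral_finsetSum _ fun q hq => hpi p hp q hq,
      Finset.sum_eq_single p (fun q hq hqp => hoff p hp q hq hqp.symm) (fun h => absurd hp h),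
      hdiag p hp]
  rw [Finset.sum_congr rfl this, Finset.sum_const, nsmul_eq_mul, hcard]
  simp only [sq]

lemma sum_pairs_add (f : ℕ → ℝ) (n : ℕ) :
    ∑ j ∈ Finset.range n, ∑ i ∈ Finset.range j, (f i + f j)
      = ((n : ℝ) - 1) * ∑ i ∈ Finset.range n, f i := by
  induction n with
  | zero => simp
  | succ n ih =>
    rw [Finset.sum_range_succ, ih, Finset.sum_add_distrib, Finset.sum_range_succ _ n]
    simp
    ring

/-- The normalized degenerate part of a `U`-statistic is negligible. -/
lemma tendstoInMeasure_degenerate (hind : iIndepFun Y P) (hlaw : ∀ i, HasLaw (Y i) ν P)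
    (hgm : Measurable (fun p : E × E => g p.1 p.2)) (hsymm : ∀ x y, g x y = g y x)
    (hg : MemLp (fun p : E × E => g p.1 p.2) 2 (ν.prod ν))
    (hdeg : ∀ᵐ y ∂ν, ∫ x, g x y ∂ν = 0) :
    TendstoInMeasure P (fun (n : ℕ) ω => Real.sqrt n * (2 / ((n : ℝ) * ((n : ℝ) - 1)) *
      ∑ j ∈ Finset.range n, ∑ i ∈ Finset.range j, g (Y i ω) (Y j ω))) atTop 0 := by
  rw [tendstoInMeasure_iff_measureReal_norm]
  intro ε hε
  set σ := ∫ p, g p.1 p.2 ^ 2 ∂(ν.prod ν)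
  have hlim : Tendsto (fun n : ℕ => (ε ^ 2)⁻¹ * (2 * σ * ((n : ℝ) - 1)⁻¹)) atTop (nhds 0) := by
    have h : Tendsto (fun n : ℕ => ((n : ℝ) - 1)⁻¹) atTop (nhds 0) :=
      tendsto_inv_atTop_zero.comp
        (tendsto_atTop_add_const_right _ (-1) tendsto_natCast_atTop_atTop)
    simpa using (h.const_mul (2 * σ)).const_mul (ε ^ 2)⁻¹
  refine squeeze_zero' (Eventually.of_forall fun n => measureReal_nonneg) ?_ hlim
  filter_upwards [eventually_ge_atTop 2] with n hn
  obtain ⟨hint, heq⟩ := integrable_and_integral_sq_sum_degenerate hind hlaw hgm hsymm hg hdeg n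
  have hn' : (2 : ℝ) ≤ n := by exact_mod_cast hn
  set R : Ω → ℝ := fun ω => Real.sqrt n * (2 / ((n : ℝ) * ((n : ℝ) - 1)) *
      ∑ j ∈ Finset.range n, ∑ i ∈ Finset.range j, g (Y i ω) (Y j ω)) with hR
  have hRsq : ∀ ω, R ω ^ 2 = (4 / ((n : ℝ) * ((n : ℝ) - 1) ^ 2)) *
      (∑ j ∈ Finset.range n, ∑ i ∈ Finset.range j, g (Y i ω) (Y j ω)) ^ 2 := by
    intro ω
    have : ((n : ℝ) - 1) ≠ 0 := by linarith
    simp only [hR, mul_pow]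
    rw [Real.sq_sqrt (by positivity)]
    field_simp
    ring
  have hRint : Integrable (fun ω => R ω ^ 2) P := by
    simp_rw [hRsq]
    exact hint.const_mul _
  have hm := mul_meas_ge_le_integral_of_nonneg (ae_of_all P fun ω => sq_nonneg (R ω)) hRint (ε ^ 2)
  have hval : ∫ ω, R ω ^ 2 ∂P = 2 * σ * ((n : ℝ) - 1)⁻¹ := by
    have : ((n : ℝ) - 1) ≠ 0 := by linarith
    simp_rw [hRsq]
    rw [integral_const_mul, heq]
    field_simp
    ring
  rw [hval] at hm
  have hset : {ω | ε ≤ ‖R ω - (0 : Ω → ℝ) ω‖} = {ω | ε ^ 2 ≤ R ω ^ 2} := by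
    ext ω
    simp only [Set.mem_ofPred_eq, Pi.zero_apply, sub_zero, Real.norm_eq_abs]
    rw [sq_le_sq, abs_of_pos hε]
  change P.real {ω | ε ≤ ‖R ω - (0 : Ω → ℝ) ω‖} ≤ _
  rw [hset, inv_mul_eq_div, le_div_iff₀ (by positivity), mul_comm]
  exact hm

/-- **Hoeffding's central limit theorem** for `U`-statistics of degree two with a centred
symmetric square-integrable kernel. -/
theorem tendstoInDistribution_uStatistic {h : E → E → ℝ} (hind : iIndepFun Y P)
    (hlaw : ∀ i, HasLaw (Y i) ν P)
    (hm : Measurable (fun p : E × E => h p.1 p.2)) (hsymm : ∀ x y, h x y = h y x)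
    (hL : MemLp (fun p : E × E => h p.1 p.2) 2 (ν.prod ν))
    (hproj : MemLp (fun x => ∫ y, h x y ∂ν) 2 ν)
    (hcent : ∫ p, h p.1 p.2 ∂(ν.prod ν) = 0) :
    TendstoInDistribution (fun (n : ℕ) ω => Real.sqrt n * (2 / ((n : ℝ) * ((n : ℝ) - 1)) *
        ∑ j ∈ Finset.range n, ∑ i ∈ Finset.range j, h (Y i ω) (Y j ω)))
      atTop (id : ℝ → ℝ) (fun _ => P)
      (gaussianReal 0 (4 * Var[fun x => ∫ y, h x y ∂ν; ν]).toNNReal) := by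
  set φ : E → ℝ := fun x => ∫ y, h x y ∂ν with hφ
  have hφm : Measurable φ := by
    have : StronglyMeasurable (Function.uncurry h) := hm.stronglyMeasurable
    exact this.integral_prod_right.measurable
  have hhint := hL.integrable one_le_two
  have hφ0 : ∫ x, φ x ∂ν = 0 := by
    rw [← hcent, integral_prod _ hhint]
  have hlawφ : ∀ i, HasLaw (fun ω => 2 * φ (Y i ω)) (ν.map fun x => 2 * φ x) P := fun i =>
    HasLaw.fun_comp (Y := fun x => 2 * φ x) ⟨(hφm.const_mul 2).aemeasurable, rfl⟩ (hlaw i)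
  have hclt := tendstoInDistribution_inv_sqrt_mul_sum_sub (P := P)
    (X := fun i ω => 2 * φ (Y i ω)) (Y := (id : ℝ → ℝ))
    (P' := gaussianReal 0 (Var[fun ω => 2 * φ (Y 0 ω); P]).toNNReal)
    HasLaw.id
    (by
      have : MemLp φ 2 (P.map (Y 0)) := by rwa [(hlaw 0).map_eq]
      exact ((memLp_map_measure_iff this.1 (hlaw 0).aemeasurable).1 this).const_mul 2)
    (hind.comp (fun _ x => 2 * φ x) fun _ => hφm.const_mul 2)
    (fun i => ⟨(hlawφ i).aemeasurable, (hlawφ 0).aemeasurable,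
      by rw [(hlawφ i).map_eq, (hlawφ 0).map_eq]⟩)
  have hvar : Var[fun ω => 2 * φ (Y 0 ω); P] = 4 * Var[φ; ν] := by
    rw [variance_const_mul, ← (hlaw 0).map_eq,
      variance_map (X := φ) hφm.aemeasurable (hlaw 0).aemeasurable]
    norm_num
    rfl
  have hmean : ∫ ω, 2 * φ (Y 0 ω) ∂P = 0 := by
    rw [integral_const_mul, ← integral_map (hlaw 0).aemeasurable hφm.aestronglyMeasurable,
      (hlaw 0).map_eq, hφ0, mul_zero]
  rw [hvar] at hclt
  simp only [hmean, mul_zero, sub_zero] at hclt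
  let g : E → E → ℝ := fun x y => h x y - φ x - φ y
  have hgm : Measurable (fun p : E × E => g p.1 p.2) :=
    (hm.sub (hφm.comp measurable_fst)).sub (hφm.comp measurable_snd)
  have hgL : MemLp (fun p : E × E => g p.1 p.2) 2 (ν.prod ν) :=
    (hL.sub (hproj.comp_fst ν)).sub (hproj.comp_snd ν)
  have hφint : Integrable φ ν := hproj.integrable one_le_two
  have hdeg : ∀ᵐ y ∂ν, ∫ x, g x y ∂ν = 0 := by
    filter_upwards [hhint.prod_left_ae] with y hy
    have h2 : ∫ x, h x y ∂ν = φ y := by simp_rw [hφ, hsymm y]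
    simp only [g]
    have h3 : Integrable (fun x => h x y - φ x) ν := hy.sub hφint
    rw [integral_sub h3 (integrable_const _), integral_sub hy hφint, h2, hφ0]
    simp
  have hgsymm : ∀ x y, g x y = g y x := fun x y => by
    simp only [g, hsymm x y]; ring
  have hrem := tendstoInMeasure_degenerate hind hlaw hgm hgsymm hgL hdeg
  refine tendstoInDistribution_of_tendstoInMeasure_sub _ _ hclt ?_ ?_
  · refine hrem.congr' ?_ (ae_eq_refl _)
    filter_upwards [eventually_ge_atTop 2] with n hn
    refine ae_of_all _ fun ω => ?_
    have hn' : (2 : ℝ) ≤ n := by exact_mod_cast hn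
    have hn1 : ((n : ℝ) - 1) ≠ 0 := by linarith
    have hdec : ∑ j ∈ Finset.range n, ∑ i ∈ Finset.range j, g (Y i ω) (Y j ω)
        = ∑ j ∈ Finset.range n, ∑ i ∈ Finset.range j, h (Y i ω) (Y j ω)
          - ((n : ℝ) - 1) * ∑ i ∈ Finset.range n, φ (Y i ω) := by
      rw [← sum_pairs_add (fun i => φ (Y i ω))]
      simp only [← Finset.sum_sub_distrib, g, sub_sub]
    have hs : Real.sqrt n ≠ 0 := by positivity
    have hss : Real.sqrt n * Real.sqrt n = n := Real.mul_self_sqrt (by positivity)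
    simp only [Pi.sub_apply]
    rw [hdec, ← Finset.mul_sum]
    have h3 : (Real.sqrt n)⁻¹ = Real.sqrt n / n := by
      rw [eq_div_iff (by positivity), inv_mul_eq_div, div_eq_iff hs, hss]
    rw [h3]
    field_simp
  · intro n
    refine (AEMeasurable.const_mul ?_ _).const_mul _
    refine Finset.aemeasurable_fun_sum _ fun j _ => Finset.aemeasurable_fun_sum _ fun i _ => ?_
    exact hm.comp_aemeasurable ((hlaw i).aemeasurable.prodMk (hlaw j).aemeasurable)

end UStatistic

namespace ExpTest

section ExpMeasure

instance : IsProbabilityMeasure (expMeasure 1) := isProbabilityMeasure_expMeasure one_pos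

lemma expMeasure_one_eq_withDensity :
    expMeasure 1 = (volume.restrict (Set.Ioi (0 : ℝ))).withDensity
      (fun y => ENNReal.ofReal (Real.exp (-y))) := by
  rw [← withDensity_indicator measurableSet_Ioi]
  refine withDensity_congr_ae ?_
  filter_upwards [Measure.ae_ne volume (0 : ℝ)] with y hy
  change exponentialPDF 1 y = _
  rw [exponentialPDF_eq]
  rcases lt_or_gt_of_ne hy with h | h
  · simp [Set.indicator, h.not_ge, h.le]
  · simp [Set.indicator, h, h.le]

lemma integral_expMeasure_one (f : ℝ → ℝ) :
    ∫ y, f y ∂(expMeasure 1) = ∫ y in Set.Ioi (0 : ℝ), f y * Real.exp (-y) := by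
  rw [expMeasure_one_eq_withDensity, integral_withDensity_eq_integral_toReal_smul (by fun_prop)
    (by simp)]
  refine integral_congr_ae (ae_of_all _ fun y => ?_)
  simp [ENNReal.toReal_ofReal (Real.exp_pos _).le, mul_comm]

lemma integrable_expMeasure_one_iff {f : ℝ → ℝ} :
    Integrable f (expMeasure 1) ↔
      IntegrableOn (fun y => f y * Real.exp (-y)) (Set.Ioi (0 : ℝ)) := by
  rw [expMeasure_one_eq_withDensity, integrable_withDensity_iff (by fun_prop) (by simp)]
  simp [ENNReal.toReal_ofReal (Real.exp_pos _).le, IntegrableOn]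

lemma ae_pos_expMeasure_one : ∀ᵐ y ∂(expMeasure 1), 0 < y := by
  rw [expMeasure_one_eq_withDensity]
  exact (withDensity_absolutelyContinuous _ _).ae_le (ae_restrict_mem measurableSet_Ioi)

lemma ae_pos_expMeasure_one_prod :
    ∀ᵐ p ∂((expMeasure 1).prod (expMeasure 1)), 0 < p.1 ∧ 0 < p.2 :=
  (Measure.quasiMeasurePreserving_fst.ae ae_pos_expMeasure_one).and
    (Measure.quasiMeasurePreserving_snd.ae ae_pos_expMeasure_one)

lemma hasLaw_const_mul_expMeasure {Ω : Type*} [MeasurableSpace Ω] {P : Measure Ω} {X : Ω → ℝ}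
    {rate : ℝ} (hrate : 0 < rate) (hX : HasLaw X (expMeasure rate) P) :
    HasLaw (fun ω => rate * X ω) (expMeasure 1) P := by
  have := isProbabilityMeasure_expMeasure hrate
  have hm : Measurable fun x : ℝ => rate * x := by fun_prop
  have : IsProbabilityMeasure ((expMeasure rate).map fun x => rate * x) :=
    Measure.isProbabilityMeasure_map hm.aemeasurable
  refine HasLaw.fun_comp (Y := fun x : ℝ => rate * x) ⟨hm.aemeasurable, ?_⟩ hX
  refine Measure.eq_of_cdf _ _ ?_
  ext x
  have hpre : (fun x : ℝ => rate * x) ⁻¹' Set.Iic x = Set.Iic (x / rate) := by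
    ext y
    simp [le_div_iff₀ hrate, mul_comm]
  rw [cdf_eq_real, map_measureReal_apply hm measurableSet_Iic, hpre, ← cdf_eq_real,
    cdf_expMeasure_eq hrate, cdf_expMeasure_eq one_pos]
  have h1 : (0 ≤ x / rate) ↔ 0 ≤ x := by
    rw [le_div_iff₀ hrate, zero_mul]
  simp only [h1, mul_div_cancel₀ x hrate.ne', one_mul]

lemma frequently_atTop_of_ae_expMeasure_one {p : ℝ → Prop} (h : ∀ᵐ y ∂(expMeasure 1), p y) :
    ∃ᶠ y in atTop, p y := by
  intro hnot
  obtain ⟨N, hN⟩ := eventually_atTop.1 hnot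
  have hIic : ∀ᵐ y ∂(expMeasure 1), y ∈ Set.Iic (max N 0) := by
    filter_upwards [h] with y hy
    by_contra hlt
    simp only [Set.mem_Iic, not_le] at hlt
    exact hN y ((le_max_left _ _).trans hlt.le) hy
  have h1 : (expMeasure 1).real (Set.Iic (max N 0)) = 1 := by
    rw [measureReal_def, (mem_ae_iff_prob_eq_one measurableSet_Iic).1 hIic]
    simp
  rw [← cdf_eq_real, cdf_expMeasure_eq one_pos, if_pos (le_max_right _ _)] at h1
  have := Real.exp_pos (-(1 * max N 0))
  linarith

lemma integrable_sq_expMeasure_one : Integrable (fun y : ℝ => y ^ 2) (expMeasure 1) := by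
  rw [integrable_expMeasure_one_iff]
  refine (Real.GammaIntegral_convergent (s := 3) (by norm_num)).congr_fun (fun y hy => ?_)
    measurableSet_Ioi
  have : (3 : ℝ) - 1 = (2 : ℕ) := by norm_num
  simp only [this, Real.rpow_natCast]
  ring

lemma integrable_exp_neg_expMeasure_one {f : ℝ → ℝ} (hf : Measurable f)
    (hnonneg : ∀ y, 0 < y → 0 ≤ f y) :
    Integrable (fun y => Real.exp (-(f y))) (expMeasure 1) := by
  refine Integrable.of_bound (C := 1) (by fun_prop) ?_
  filter_upwards [ae_pos_expMeasure_one] with y hy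
  rw [Real.norm_of_nonneg (Real.exp_pos _).le, Real.exp_le_one_iff]
  linarith [hnonneg y hy]

end ExpMeasure

section Integrals

lemma setIntegral_Ioi_add_right (g : ℝ → ℝ) (a b : ℝ) :
    ∫ x in Set.Ioi a, g (x + b) = ∫ x in Set.Ioi (a + b), g x := by
  have h := (measurePreserving_add_right volume b).setIntegral_preimage_emb
    (measurableEmbedding_addRight b) g (Set.Ioi (a + b))
  simpa using h

lemma mul_exp_mul_expIntegralE1 {μ : ℝ} (hμ : 0 < μ) :
    μ * Real.exp μ * expIntegralE1 μ = ∫ x, μ / (x + μ) ∂(expMeasure 1) := by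
  have h1 : expIntegralE1 μ = ∫ u in Set.Ioi μ, Real.exp (-u) / u := by
    have h := integral_comp_mul_left_Ioi' (fun u => Real.exp (-u) / u) 1 hμ
    rw [mul_one] at h
    rw [← h, expIntegralE1, smul_eq_mul, ← integral_const_mul]
    refine integral_congr_ae (ae_of_all _ fun t => ?_)
    simp only
    field_simp
  have h2 := setIntegral_Ioi_add_right (fun u => Real.exp (-u) / u) 0 μ
  rw [zero_add] at h2
  rw [h1, ← h2, integral_expMeasure_one, ← integral_const_mul]
  refine integral_congr_ae (ae_of_all _ fun x => ?_)
  simp only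
  rw [neg_add, Real.exp_add, Real.exp_neg μ]
  field_simp

lemma integrable_div_add_expMeasure_one {μ : ℝ} (hμ : 0 < μ) :
    Integrable (fun x : ℝ => μ / (x + μ)) (expMeasure 1) := by
  have hm : Measurable fun x : ℝ => μ / (x + μ) := by fun_prop
  refine Integrable.of_bound (C := 1) hm.aestronglyMeasurable ?_
  filter_upwards [ae_pos_expMeasure_one] with x hx
  rw [Real.norm_of_nonneg (by positivity), div_le_one (by positivity)]
  linarith

lemma integral_self_div_add {μ : ℝ} (hμ : 0 < μ) :
    ∫ x, x / (x + μ) ∂(expMeasure 1) = 1 - μ * Real.exp μ * expIntegralE1 μ := by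
  rw [mul_exp_mul_expIntegralE1 hμ]
  have : ∫ x, x / (x + μ) ∂(expMeasure 1) = ∫ x, (1 - μ / (x + μ)) ∂(expMeasure 1) := by
    refine integral_congr_ae ?_
    filter_upwards [ae_pos_expMeasure_one] with x hx
    field_simp
    ring
  rw [this, integral_sub (integrable_const _) (integrable_div_add_expMeasure_one hμ)]
  simp

lemma integral_exp_neg_mul_div {μ s : ℝ} (hμ : 0 < μ) (hs : 0 < s) :
    ∫ y, Real.exp (-(μ * (y / s))) ∂(expMeasure 1) = s / (s + μ) := by
  have hneg : -(μ / s + 1) < 0 := by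
    have := div_pos hμ hs
    linarith
  have h := integral_exp_mul_Ioi hneg 0
  rw [integral_expMeasure_one]
  calc _ = ∫ y in Set.Ioi (0 : ℝ), Real.exp (-(μ / s + 1) * y) := by
        refine integral_congr_ae (ae_of_all _ fun y => ?_)
        simp only
        rw [← Real.exp_add]
        congr 1
        ring
    _ = s / (s + μ) := by
        rw [h, mul_zero, Real.exp_zero, neg_div_neg_eq]
        field_simp
        ring

lemma integral_exp_neg_mul_const_div {μ s : ℝ} (hμ : 0 < μ) (hs : 0 < s) :
    ∫ y, Real.exp (-(μ * (s / y))) ∂(expMeasure 1)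
      = 2 * (Real.sqrt (μ * s) * besselK1 (2 * Real.sqrt (μ * s))) := by
  set a := Real.sqrt (μ * s) with ha
  have ha0 : 0 < a := Real.sqrt_pos.2 (mul_pos hμ hs)
  have haa : a * a = μ * s := Real.mul_self_sqrt (mul_pos hμ hs).le
  have himage : (fun u => a * Real.exp u) '' Set.univ = Set.Ioi 0 := by
    ext y
    simp only [Set.image_univ, Set.mem_range, Set.mem_Ioi]
    constructor
    · rintro ⟨u, rfl⟩
      positivity
    · intro hy
      refine ⟨Real.log (y / a), ?_⟩
      rw [Real.exp_log (by positivity)]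
      field_simp
  have hderiv : ∀ u ∈ Set.univ, HasDerivWithinAt (fun u => a * Real.exp u) (a * Real.exp u)
      Set.univ u := fun u _ => ((Real.hasDerivAt_exp u).const_mul a).hasDerivWithinAt
  have hinj : Set.InjOn (fun u => a * Real.exp u) Set.univ := fun u _ v _ huv =>
    Real.exp_injective (mul_left_cancel₀ ha0.ne' huv)
  set F : ℝ → ℝ := fun y => Real.exp (-(μ * (s / y))) * Real.exp (-y) with hF
  set G : ℝ → ℝ := fun u => a * Real.exp u * Real.exp (-(2 * a * Real.cosh u)) with hG
  have hFG : ∀ u, |a * Real.exp u| • F (a * Real.exp u) = G u := by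
    intro u
    simp only [hF, hG, smul_eq_mul]
    rw [abs_of_pos (by positivity), ← Real.exp_add]
    congr 2
    have : μ * (s / (a * Real.exp u)) = a * Real.exp (-u) := by
      rw [Real.exp_neg, ← mul_div_assoc, ← haa]
      field_simp
    rw [this, Real.cosh_eq]
    ring
  have hFint : IntegrableOn F (Set.Ioi 0) := integrable_expMeasure_one_iff.1
    (integrable_exp_neg_expMeasure_one (f := fun y => μ * (s / y)) (by fun_prop)
      fun y hy => by positivity)
  have hGint : Integrable G := by
    rw [← himage, integrableOn_image_iff_integrableOn_abs_deriv_smul MeasurableSet.univ hderiv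
      hinj, integrableOn_univ] at hFint
    simpa only [hFG] using hFint
  have hFeq : ∫ y in Set.Ioi 0, F y = ∫ u, G u := by
    rw [← himage, integral_image_eq_integral_abs_deriv_smul MeasurableSet.univ hderiv hinj,
      setIntegral_univ]
    simp only [hFG]
  rw [integral_expMeasure_one, hFeq,
    ← intervalIntegral.integral_Iic_add_Ioi hGint.integrableOn hGint.integrableOn (b := 0)]
  have hneg := integral_comp_neg_Ioi 0 G
  rw [neg_zero] at hneg
  rw [← hneg, ← integral_add hGint.comp_neg.integrableOn hGint.integrableOn, besselK1,
    ← integral_const_mul, ← integral_const_mul]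
  refine integral_congr_ae (ae_of_all _ fun u => ?_)
  simp only [hG, Real.cosh_neg]
  nth_rewrite 4 [Real.cosh_eq]
  ring

end Integrals

lemma integral_const_sub_mul_sub_mul {α : Type*} [MeasurableSpace α] {m : Measure α}
    [IsProbabilityMeasure m] {f g : α → ℝ} (hf : Integrable f m) (hg : Integrable g m)
    (a b c : ℝ) :
    ∫ x, (a - b * f x - c * g x) ∂m = a - b * ∫ x, f x ∂m - c * ∫ x, g x ∂m := by
  have h : Integrable (fun x => a - b * f x) m := (integrable_const _).sub (hf.const_mul _)
  rw [integral_sub h (hg.const_mul _), integral_sub (integrable_const _) (hf.const_mul _),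
    integral_const_mul, integral_const_mul]
  simp

section Kernel

lemma kernel_comm (μ x y : ℝ) : kernel μ x y = kernel μ y x := by
  simp only [kernel]
  ring

lemma kernel_const_mul {c : ℝ} (hc : c ≠ 0) (μ x y : ℝ) :
    kernel μ (c * x) (c * y) = kernel μ x y := by
  simp only [kernel, mul_div_mul_left _ _ hc]

lemma measurable_kernel (μ : ℝ) : Measurable (fun p : ℝ × ℝ => kernel μ p.1 p.2) := by
  unfold kernel
  fun_prop

lemma measurable_projection (μ : ℝ) : Measurable (projection μ) := by
  have : StronglyMeasurable (Function.uncurry (kernel μ)) :=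
    (measurable_kernel μ).stronglyMeasurable
  exact this.integral_prod_right.measurable

lemma norm_kernel_le {μ x y : ℝ} (hμ : 0 < μ) (hx : 0 < x) (hy : 0 < y) :
    ‖kernel μ x y‖ ≤ |1 - μ * Real.exp μ * expIntegralE1 μ| + 1 := by
  have h1 : Real.exp (-(μ * (x / y))) ≤ 1 :=
    Real.exp_le_one_iff.2 (neg_nonpos.2 (by positivity))
  have h2 : Real.exp (-(μ * (y / x))) ≤ 1 :=
    Real.exp_le_one_iff.2 (neg_nonpos.2 (by positivity))
  have h3 := Real.exp_pos (-(μ * (x / y)))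
  have h4 := Real.exp_pos (-(μ * (y / x)))
  rw [Real.norm_eq_abs, kernel]
  have h5 := le_abs_self (1 - μ * Real.exp μ * expIntegralE1 μ)
  have h6 := neg_abs_le (1 - μ * Real.exp μ * expIntegralE1 μ)
  rw [abs_le]
  constructor <;> linarith

lemma memLp_kernel {μ : ℝ} (hμ : 0 < μ) :
    MemLp (fun p : ℝ × ℝ => kernel μ p.1 p.2) 2 ((expMeasure 1).prod (expMeasure 1)) := by
  refine MemLp.of_bound (measurable_kernel μ).aestronglyMeasurable
    (|1 - μ * Real.exp μ * expIntegralE1 μ| + 1) ?_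
  filter_upwards [ae_pos_expMeasure_one_prod] with p hp
  exact norm_kernel_le hμ hp.1 hp.2

lemma integrable_kernel_left {μ s : ℝ} (hμ : 0 < μ) (hs : 0 < s) :
    Integrable (fun y => kernel μ s y) (expMeasure 1) := by
  refine Integrable.of_bound ((measurable_kernel μ).of_uncurry_left (x := s)).aestronglyMeasurable
    (|1 - μ * Real.exp μ * expIntegralE1 μ| + 1) ?_
  filter_upwards [ae_pos_expMeasure_one] with y hy
  exact norm_kernel_le hμ hs hy

lemma projection_eq_integral {μ s : ℝ} (hμ : 0 < μ) (hs : 0 < s) :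
    projection μ s = 1 - μ * Real.exp μ * expIntegralE1 μ
      - 1 / 2 * ∫ y, Real.exp (-(μ * (s / y))) ∂(expMeasure 1) - s / (2 * (μ + s)) := by
  have h1 : Integrable (fun y => Real.exp (-(μ * (s / y)))) (expMeasure 1) :=
    integrable_exp_neg_expMeasure_one (by fun_prop) fun y hy => by positivity
  have h2 : Integrable (fun y => Real.exp (-(μ * (y / s)))) (expMeasure 1) :=
    integrable_exp_neg_expMeasure_one (by fun_prop) fun y hy => by positivity
  unfold projection kernel
  rw [integral_const_sub_mul_sub_mul h1 h2,
    integral_exp_neg_mul_div hμ hs]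
  have : μ + s ≠ 0 := by positivity
  rw [add_comm s μ]
  field_simp

lemma projection_eq {μ s : ℝ} (hμ : 0 < μ) (hs : 0 < s) :
    projection μ s = 1 - μ * Real.exp μ * expIntegralE1 μ
      - Real.sqrt (μ * s) * besselK1 (2 * Real.sqrt (μ * s)) - s / (2 * (μ + s)) := by
  rw [projection_eq_integral hμ hs, integral_exp_neg_mul_const_div hμ hs]
  ring

lemma memLp_projection {μ : ℝ} (hμ : 0 < μ) : MemLp (projection μ) 2 (expMeasure 1) := by
  refine MemLp.of_bound (measurable_projection μ).aestronglyMeasurable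
    (|1 - μ * Real.exp μ * expIntegralE1 μ| + 1) ?_
  filter_upwards [ae_pos_expMeasure_one] with s hs
  have h := norm_integral_le_of_norm_le_const (μ := expMeasure 1) (f := fun y => kernel μ s y)
    (ae_pos_expMeasure_one.mono fun y hy => norm_kernel_le hμ hs hy)
  simpa [projection] using h

lemma integral_kernel {μ : ℝ} (hμ : 0 < μ) :
    ∫ p : ℝ × ℝ, kernel μ p.1 p.2 ∂((expMeasure 1).prod (expMeasure 1)) = 0 := by
  have hi : ∀ f : ℝ × ℝ → ℝ, Measurable f → (∀ p, 0 < p.1 → 0 < p.2 → 0 ≤ f p) →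
      Integrable (fun p => Real.exp (-(f p))) ((expMeasure 1).prod (expMeasure 1)) := by
    intro f hf hnn
    refine Integrable.of_bound (C := 1) (by fun_prop) ?_
    filter_upwards [ae_pos_expMeasure_one_prod] with p hp
    rw [Real.norm_of_nonneg (Real.exp_pos _).le, Real.exp_le_one_iff]
    linarith [hnn p hp.1 hp.2]
  have h1 := hi (fun p => μ * (p.1 / p.2)) (by fun_prop) fun p h h' => by positivity
  have h2 := hi (fun p => μ * (p.2 / p.1)) (by fun_prop) fun p h h' => by positivity
  have hv : ∫ x, ∫ y, Real.exp (-(μ * (y / x))) ∂(expMeasure 1) ∂(expMeasure 1)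
      = 1 - μ * Real.exp μ * expIntegralE1 μ := by
    rw [← integral_self_div_add hμ]
    refine integral_congr_ae ?_
    filter_upwards [ae_pos_expMeasure_one] with x hx
    exact integral_exp_neg_mul_div hμ hx
  unfold kernel
  rw [integral_const_sub_mul_sub_mul h1 h2,
    integral_prod_symm _ h1, integral_prod _ h2, hv]
  ring

lemma integral_projection {μ : ℝ} (hμ : 0 < μ) : ∫ s, projection μ s ∂(expMeasure 1) = 0 := by
  rw [← integral_kernel hμ, integral_prod _ ((memLp_kernel hμ).integrable one_le_two)]
  rfl

lemma variance_projection {μ : ℝ} (hμ : 0 < μ) :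
    Var[projection μ; expMeasure 1] = deltaSq μ := by
  rw [variance_of_integral_eq_zero (measurable_projection μ).aemeasurable
    (integral_projection hμ), deltaSq, integral_expMeasure_one]

lemma integral_exp_neg_mul_const_div_le {μ s : ℝ} (hμ : 0 < μ) (hs : 0 < s) :
    ∫ y, Real.exp (-(μ * (s / y))) ∂(expMeasure 1)
      ≤ 2 / μ ^ 2 * (∫ y, y ^ 2 ∂(expMeasure 1)) / s ^ 2 := by
  have hle : ∫ y, Real.exp (-(μ * (s / y))) ∂(expMeasure 1)
      ≤ ∫ y, 2 / (μ ^ 2 * s ^ 2) * y ^ 2 ∂(expMeasure 1) := by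
    refine integral_mono_ae (integrable_exp_neg_expMeasure_one (by fun_prop)
      fun y hy => by positivity) (integrable_sq_expMeasure_one.const_mul _) ?_
    filter_upwards [ae_pos_expMeasure_one] with y hy
    have hz : 0 < μ * (s / y) := by positivity
    have hq := Real.quadratic_le_exp_of_nonneg hz.le
    rw [Real.exp_neg]
    calc (Real.exp (μ * (s / y)))⁻¹ ≤ ((μ * (s / y)) ^ 2 / 2)⁻¹ := by
          refine inv_anti₀ (by positivity) ?_
          linarith
      _ = 2 / (μ ^ 2 * s ^ 2) * y ^ 2 := by
          field_simp
  refine hle.trans_eq ?_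
  rw [integral_const_mul]
  field_simp

lemma tendsto_mul_integral_exp_neg_mul_const_div {μ : ℝ} (hμ : 0 < μ) :
    Tendsto (fun s => s * ∫ y, Real.exp (-(μ * (s / y))) ∂(expMeasure 1)) atTop (nhds 0) := by
  have hlim : Tendsto (fun s : ℝ => 2 / μ ^ 2 * (∫ y, y ^ 2 ∂(expMeasure 1)) * s⁻¹) atTop
      (nhds 0) := by
    have h := (tendsto_inv_atTop_zero (𝕜 := ℝ)).const_mul
      (2 / μ ^ 2 * (∫ y, y ^ 2 ∂(expMeasure 1)))
    rwa [mul_zero] at h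
  refine squeeze_zero' ?_ ?_ hlim
  · filter_upwards [eventually_gt_atTop 0] with s hs
    exact mul_nonneg hs.le (integral_nonneg fun y => (Real.exp_pos _).le)
  · filter_upwards [eventually_gt_atTop 0] with s hs
    refine (mul_le_mul_of_nonneg_left (integral_exp_neg_mul_const_div_le hμ hs) hs.le).trans_eq ?_
    field_simp

/-- The projection does not vanish almost everywhere: otherwise `E e^{-μ s / Y}`, which decays
faster than `1 / s`, would differ from `μ / (μ + s)` by a constant. -/
lemma not_projection_ae_eq_zero {μ : ℝ} (hμ : 0 < μ) :
    ¬ projection μ =ᵐ[expMeasure 1] 0 := by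
  intro h0
  set A : ℝ → ℝ := fun s => ∫ y, Real.exp (-(μ * (s / y))) ∂(expMeasure 1) with hA
  set d := 1 - 2 * (μ * Real.exp μ * expIntegralE1 μ) with hd
  have hfreq : ∃ᶠ s in atTop, 0 < s ∧ A s - μ / (μ + s) = d := by
    refine frequently_atTop_of_ae_expMeasure_one ?_
    filter_upwards [h0, ae_pos_expMeasure_one] with s hs hpos
    refine ⟨hpos, ?_⟩
    rw [projection_eq_integral hμ hpos] at hs
    have h1 : s / (2 * (μ + s)) = 1 / 2 - μ / (μ + s) / 2 := by
      field_simp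
      ring
    rw [h1] at hs
    simp only [Pi.zero_apply] at hs
    simp only [hA, hd]
    linarith
  have hsA := tendsto_mul_integral_exp_neg_mul_const_div hμ
  have hsub : Tendsto (fun s : ℝ => s * (μ / (μ + s))) atTop (nhds μ) := by
    have h1 : Tendsto (fun s : ℝ => μ - μ ^ 2 * (μ + s)⁻¹) atTop (nhds (μ - μ ^ 2 * 0)) :=
      ((tendsto_inv_atTop_zero.comp (tendsto_atTop_add_const_left _ μ tendsto_id)).const_mul
        (μ ^ 2)).const_sub μ
    rw [mul_zero, sub_zero] at h1
    refine h1.congr' ?_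
    filter_upwards [eventually_gt_atTop 0] with s hs
    field_simp
    ring
  have hsD : Tendsto (fun s => s * (A s - μ / (μ + s))) atTop (nhds (0 - μ)) := by
    simpa only [mul_sub] using hsA.sub hsub
  have hD : Tendsto (fun s => A s - μ / (μ + s)) atTop (nhds 0) := by
    have h1 := tendsto_inv_atTop_zero.mul hsD
    rw [zero_mul] at h1
    refine h1.congr' ?_
    filter_upwards [eventually_gt_atTop 0] with s hs
    field_simp
  have hd0 : (0 : ℝ) = d :=
    (isClosed_singleton (x := d)).mem_of_frequently_of_tendsto
      (hfreq.mono fun s hs => hs.2) hD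
  have hμ0 : 0 - μ = 0 :=
    (isClosed_singleton (x := (0 : ℝ))).mem_of_frequently_of_tendsto
      (hfreq.mono fun s hs => by simp [hs.2, ← hd0]) hsD
  linarith

lemma deltaSq_pos {μ : ℝ} (hμ : 0 < μ) : 0 < deltaSq μ := by
  have h : deltaSq μ = ∫ s, projection μ s ^ 2 ∂(expMeasure 1) := by
    rw [integral_expMeasure_one, deltaSq]
  rw [h]
  refine (integral_nonneg fun s => sq_nonneg _).lt_of_ne' fun h0 => ?_
  rw [integral_eq_zero_iff_of_nonneg (fun s => sq_nonneg _) (memLp_projection hμ).integrable_sq]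
    at h0
  refine not_projection_ae_eq_zero hμ ?_
  filter_upwards [h0] with s hs
  simpa using hs

end Kernel

section Statistic

lemma integrableOn_mul_exp_neg_mul {μ : ℝ} (hμ : 0 < μ) (a : ℝ) :
    IntegrableOn (fun t => μ * Real.exp (-(μ * t))) (Set.Ioi a) := by
  simpa only [neg_mul, IntegrableOn] using (integrableOn_exp_mul_Ioi (neg_lt_zero.2 hμ) a).const_mul μ

lemma integral_mul_exp_neg_mul {μ : ℝ} (hμ : 0 < μ) (a : ℝ) :
    ∫ t in Set.Ioi a, μ * Real.exp (-(μ * t)) = Real.exp (-(μ * a)) := by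
  have h := integral_exp_mul_Ioi (neg_lt_zero.2 hμ) a
  simp only [neg_mul] at h
  rw [integral_const_mul, h]
  field_simp

lemma integrableOn_indicator_mul_exp {μ : ℝ} (hμ : 0 < μ) (r : ℝ) :
    IntegrableOn (fun t => (Set.Iio t).indicator (fun _ => (1 : ℝ)) r *
      (μ * Real.exp (-(μ * t)))) (Set.Ioi 0) := by
  refine ((integrableOn_mul_exp_neg_mul hμ 0).indicator (measurableSet_Ioi (a := r))).congr
    (ae_of_all _ fun t => ?_)
  by_cases h : r < t <;> simp [Set.indicator, h]

lemma integral_indicator_mul_exp {μ r : ℝ} (hμ : 0 < μ) (hr : 0 < r) :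
    ∫ t in Set.Ioi (0 : ℝ), (Set.Iio t).indicator (fun _ => (1 : ℝ)) r *
      (μ * Real.exp (-(μ * t))) = Real.exp (-(μ * r)) := by
  have h : ∀ t, (Set.Iio t).indicator (fun _ => (1 : ℝ)) r * (μ * Real.exp (-(μ * t)))
      = (Set.Ioi r).indicator (fun t => μ * Real.exp (-(μ * t))) t := by
    intro t
    by_cases h : r < t <;> simp [Set.indicator, h]
  simp_rw [h]
  rw [setIntegral_indicator measurableSet_Ioi, Set.Ioi_inter_Ioi, max_eq_right hr.le,
    integral_mul_exp_neg_mul hμ]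

lemma integrableOn_div_mul_exp {μ : ℝ} (hμ : 0 < μ) :
    IntegrableOn (fun t => t / (1 + t) * (μ * Real.exp (-(μ * t)))) (Set.Ioi 0) := by
  have hm : Measurable fun t : ℝ => t / (1 + t) * (μ * Real.exp (-(μ * t))) := by fun_prop
  refine (integrableOn_mul_exp_neg_mul hμ 0).mono' hm.aestronglyMeasurable ?_
  filter_upwards [ae_restrict_mem measurableSet_Ioi] with t ht
  have ht' : 0 < t := ht
  rw [Real.norm_of_nonneg (by positivity)]
  refine mul_le_of_le_one_left (by positivity) ?_
  rw [div_le_one (by positivity)]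
  linarith

lemma integral_div_mul_exp {μ : ℝ} (hμ : 0 < μ) :
    ∫ t in Set.Ioi (0 : ℝ), t / (1 + t) * (μ * Real.exp (-(μ * t)))
      = 1 - μ * Real.exp μ * expIntegralE1 μ := by
  rw [← integral_self_div_add hμ, integral_expMeasure_one]
  have h := integral_comp_mul_left_Ioi' (fun x => x / (x + μ) * Real.exp (-x)) 0 hμ
  rw [mul_zero] at h
  rw [← h, smul_eq_mul, ← integral_const_mul]
  refine setIntegral_congr_fun measurableSet_Ioi fun t ht => ?_
  have ht' : 0 < t := ht
  have : μ * t + μ ≠ 0 := by positivity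
  field_simp
  ring

lemma statW_eq {μ : ℝ} (hμ : 0 < μ) {n : ℕ} (hn : 2 ≤ n) {x : ℕ → ℝ} (hx : ∀ i, 0 < x i) :
    statW μ n x = 2 / ((n : ℝ) * ((n : ℝ) - 1)) *
      ∑ j ∈ Finset.range n, ∑ i ∈ Finset.range j, kernel μ (x i) (x j) := by
  set I : ℝ → ℝ → ℝ := fun r t =>
    (Set.Iio t).indicator (fun _ => (1 : ℝ)) r * (μ * Real.exp (-(μ * t))) with hI
  set S := ∑ j ∈ Finset.range n, ∑ i ∈ Finset.range j,
    (Real.exp (-(μ * (x i / x j))) + Real.exp (-(μ * (x j / x i)))) with hS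
  have hIint : ∀ i j : ℕ, IntegrableOn (fun t => I (x i / x j) t + I (x j / x i) t) (Set.Ioi 0) :=
    fun i j => (integrableOn_indicator_mul_exp hμ _).add (integrableOn_indicator_mul_exp hμ _)
  have hsumint : ∀ j : ℕ, IntegrableOn
      (fun t => ∑ i ∈ Finset.range j, (I (x i / x j) t + I (x j / x i) t)) (Set.Ioi 0) :=
    fun j => integrable_finsetSum _ fun i _ => hIint i j
  have hdf : ∀ t, (t / (1 + t) - ratioDF n x t) * (μ * Real.exp (-(μ * t)))
      = t / (1 + t) * (μ * Real.exp (-(μ * t))) - 1 / ((n : ℝ) * ((n : ℝ) - 1)) *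
        ∑ j ∈ Finset.range n, ∑ i ∈ Finset.range j, (I (x i / x j) t + I (x j / x i) t) := by
    intro t
    simp only [ratioDF, hI, ← add_mul, ← Finset.sum_mul]
    ring
  have hW : statW μ n x
      = 1 - μ * Real.exp μ * expIntegralE1 μ - 1 / ((n : ℝ) * ((n : ℝ) - 1)) * S := by
    unfold statW
    simp_rw [hdf]
    rw [integral_sub (integrableOn_div_mul_exp hμ)
      ((integrable_finsetSum _ fun j _ => hsumint j).const_mul _), integral_div_mul_exp hμ,
      integral_const_mul, integral_finsetSum _ fun j _ => hsumint j]
    congr 2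
    refine Finset.sum_congr rfl fun j _ => ?_
    rw [integral_finsetSum _ fun i _ => hIint i j]
    refine Finset.sum_congr rfl fun i _ => ?_
    rw [integral_add (integrableOn_indicator_mul_exp hμ _) (integrableOn_indicator_mul_exp hμ _),
      integral_indicator_mul_exp hμ (div_pos (hx i) (hx j)),
      integral_indicator_mul_exp hμ (div_pos (hx j) (hx i))]
  have hU : ∑ j ∈ Finset.range n, ∑ i ∈ Finset.range j, kernel μ (x i) (x j)
      = (n : ℝ) * ((n : ℝ) - 1) / 2 * (1 - μ * Real.exp μ * expIntegralE1 μ) - 1 / 2 * S := by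
    have h := sum_pairs_add (fun _ => (1 - μ * Real.exp μ * expIntegralE1 μ) / 2) n
    rw [Finset.sum_const, Finset.card_range, nsmul_eq_mul] at h
    have hk : ∀ i j : ℕ, kernel μ (x i) (x j) =
        ((1 - μ * Real.exp μ * expIntegralE1 μ) / 2 + (1 - μ * Real.exp μ * expIntegralE1 μ) / 2)
        - 1 / 2 * (Real.exp (-(μ * (x i / x j))) + Real.exp (-(μ * (x j / x i)))) := by
      intro i j
      rw [kernel]
      ring
    simp_rw [hk, Finset.sum_sub_distrib, ← Finset.mul_sum]
    rw [h]
    ring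
  have hn' : (2 : ℝ) ≤ n := by exact_mod_cast hn
  have hn1 : (n : ℝ) - 1 ≠ 0 := by linarith
  rw [hW, hU]
  field_simp

lemma statW_of_lt_two (μ : ℝ) {n : ℕ} (hn : n < 2) (x y : ℕ → ℝ) :
    statW μ n x = statW μ n y := by
  interval_cases n <;> simp [statW, ratioDF]

end Statistic

end ExpTest

theorem theorem1 {Ω : Type*} [MeasurableSpace Ω] (P : Measure Ω) [IsProbabilityMeasure P]
    (X : ℕ → Ω → ℝ) (rate μ : ℝ) (hrate : 0 < rate) (hμ : 0 < μ)
    (hindep : iIndepFun X P) (hlaw : ∀ i, HasLaw (X i) (expMeasure rate) P) :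
    -- almost surely, the statistic is the U-statistic of degree two with the given kernel
    (∀ n : ℕ, 2 ≤ n → ∀ᵐ ω ∂P,
      ExpTest.statW μ n (fun i => X i ω) =
        2 / ((n : ℝ) * ((n : ℝ) - 1)) *
          ∑ j ∈ Finset.range n, ∑ i ∈ Finset.range j, ExpTest.kernel μ (X i ω) (X j ω)) ∧
    -- the kernel is centred
    Integrable (fun p : ℝ × ℝ => ExpTest.kernel μ p.1 p.2)
      ((expMeasure 1).prod (expMeasure 1)) ∧
    ∫ p : ℝ × ℝ, ExpTest.kernel μ p.1 p.2 ∂((expMeasure 1).prod (expMeasure 1)) = 0 ∧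
    -- closed form of the projection
    (∀ s : ℝ, 0 < s →
      Integrable (fun y => ExpTest.kernel μ s y) (expMeasure 1) ∧
      ExpTest.projection μ s =
        1 - μ * Real.exp μ * ExpTest.expIntegralE1 μ
          - Real.sqrt (μ * s) * ExpTest.besselK1 (2 * Real.sqrt (μ * s))
          - s / (2 * (μ + s))) ∧
    -- the variance of the projection; the kernel is non-degenerate
    MemLp (ExpTest.projection μ) 2 (expMeasure 1) ∧
    ProbabilityTheory.variance (ExpTest.projection μ) (expMeasure 1) = ExpTest.deltaSq μ ∧
    0 < ExpTest.deltaSq μ ∧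
    -- asymptotic normality
    TendstoInDistribution
      (fun (n : ℕ) (ω : Ω) => Real.sqrt n * ExpTest.statW μ n (fun i => X i ω))
      atTop (id : ℝ → ℝ) (fun _ => P)
      (gaussianReal 0 (Real.toNNReal (4 * ExpTest.deltaSq μ))) := by
  have hYlaw : ∀ i, HasLaw (fun ω => rate * X i ω) (expMeasure 1) P := fun i =>
    ExpTest.hasLaw_const_mul_expMeasure hrate (hlaw i)
  have hYind : iIndepFun (fun i ω => rate * X i ω) P :=
    hindep.comp (fun _ x => rate * x) fun _ => by fun_prop
  have hpos : ∀ᵐ ω ∂P, ∀ i, 0 < X i ω := by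
    refine ae_all_iff.2 fun i => ?_
    have h : ∀ᵐ y ∂(P.map fun ω => rate * X i ω), 0 < y := by
      rw [(hYlaw i).map_eq]
      exact ExpTest.ae_pos_expMeasure_one
    filter_upwards [ae_of_ae_map (hYlaw i).aemeasurable h] with ω hω
    exact (mul_pos_iff_of_pos_left hrate).1 hω
  have hstat : ∀ n : ℕ, 2 ≤ n → ∀ᵐ ω ∂P, ExpTest.statW μ n (fun i => X i ω) =
      2 / ((n : ℝ) * ((n : ℝ) - 1)) *
        ∑ j ∈ Finset.range n, ∑ i ∈ Finset.range j, ExpTest.kernel μ (X i ω) (X j ω) :=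
    fun n hn => hpos.mono fun ω hω => ExpTest.statW_eq hμ hn hω
  refine ⟨hstat, (ExpTest.memLp_kernel hμ).integrable one_le_two, ExpTest.integral_kernel hμ,
    fun s hs => ⟨ExpTest.integrable_kernel_left hμ hs, ExpTest.projection_eq hμ hs⟩,
    ExpTest.memLp_projection hμ, ExpTest.variance_projection hμ, ExpTest.deltaSq_pos hμ, ?_⟩
  have hclt := tendstoInDistribution_uStatistic hYind hYlaw (ExpTest.measurable_kernel μ)
    (ExpTest.kernel_comm μ) (ExpTest.memLp_kernel hμ) (ExpTest.memLp_projection hμ)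
    (ExpTest.integral_kernel hμ)
  change TendstoInDistribution _ _ _ _
    (gaussianReal 0 (4 * Var[ExpTest.projection μ; expMeasure 1]).toNNReal) at hclt
  rw [ExpTest.variance_projection hμ] at hclt
  simp only [ExpTest.kernel_const_mul hrate.ne'] at hclt
  have heq : ∀ n : ℕ, 2 ≤ n →
      (fun ω => Real.sqrt n * (2 / ((n : ℝ) * ((n : ℝ) - 1)) *
        ∑ j ∈ Finset.range n, ∑ i ∈ Finset.range j, ExpTest.kernel μ (X i ω) (X j ω)))
      =ᵐ[P] fun ω => Real.sqrt n * ExpTest.statW μ n (fun i => X i ω) := fun n hn =>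
    (hstat n hn).mono fun ω hω => by simp only [hω]
  refine tendstoInDistribution_of_tendstoInMeasure_sub _ _ hclt ?_ fun n => ?_
  · have hzero : TendstoInMeasure P (fun (_ : ℕ) (_ : Ω) => (0 : ℝ)) atTop 0 := by
      intro ε hε
      simp [hε.ne']
    refine hzero.congr' ?_ (ae_eq_refl _)
    filter_upwards [eventually_ge_atTop 2] with n hn
    filter_upwards [heq n hn] with ω hω
    simp only [Pi.sub_apply, hω, sub_self]
  · rcases lt_or_ge n 2 with hn | hn
    · simp only [ExpTest.statW_of_lt_two μ hn _ 0]
      exact aemeasurable_const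
    · exact (hclt.forall_aemeasurable n).congr (heq n hn)
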